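/- **Setting.** Let $d\in\mathbb N_0$. A *$d$-dimensional Feller basket* with risk-neutral measures $(\mathbb P^x)_{x\in\mathbb R^d}$ and discount rate $r>0$ consists of a filtered measurable space $(\Omega,(\mathcal F_t)_{t\ge 0})$, adapted $\mathbb R^d$-valued processes $X^x=(X^x_t)_{t\ge0}$ ($x\in\mathbb R^d$), a Feller transition function $(P_t)$, a transition function $(Q_t)$ and physical probability measures $P^x$ and probability measures $\mathbb P^x$ on $\Omega$, such that for every $x$: under $P^x$ (resp. $\mathbb P^x$) the process $X^x$ is Markov with respect to $(\mathcal F_t)$ with transition function $(P_t)$ (resp. $(Q_t)$) and starts in $x$; for each coordinate $i$ the process $\exp\big((X^x_t)_i-rt\big)$ is a $\mathbb P^x$-martingale; and for each finite $t$ the laws of $(X^x_u)_{u\le t}$ under $P^x$ and $\mathbb P^x$ are equivalent. Write $\mathbb E^x$ for the expectation under $\mathbb P^x$, and $X$ for $X^x$ under $\mathbb P^x$. Let $f:\mathbb R^d\to\mathbb R$ be measurable, $K\in\mathbb R$, $g=(K-f)\vee 0$, and suppose that $e^{-rt}f(X_t)$ is a $\mathbb P^x$-submartingale for every $x$. Let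 $T\in[0,+\infty]$, and let $\mathcal I\subset[0,+\infty)$ be a countable set of exercise times with $0\in\mathcal I$ such that $\mathcal I\cap[0,t]$ is finite for every finite $t\le T$ (for instance $\mathcal I=s\mathbb N_0$ with $s>0$). Payoffs $e^{-r\tau}g(X_\tau)$ are $0$ on $\{\tau=+\infty\}$. All expectations and suprema below are taken in $[0,+\infty]$. For a space-time region $\mathcal G\subset\mathbb R^d\times[0,+\infty)$ and a starting point $(x,t_0)$, let $X_{t-t_0}$ under $\mathbb P^x$ be the position at calendar time $t\ge t_0$, let $\tau_{\mathcal G}^{\mathcal I}=\inf\{t\in\mathcal I: t\ge t_0,\ (X_{t-t_0},t)\in\mathcal G\}$ ($=+\infty$ if there is no such $t$), and put $$V^{\mathcal I}_{\mathcal G}(x,t_0)=\begin{cases} g(x), & (x,t_0)\in\mathcal G,\\ e^{rt_0}\,\mathbb E^{x}\big[e^{-r\tau_{\mathcal G}^{\mathcal I}}g(X_{\tau_{\mathcal G}^{\mathcal I}-t_0})\big], & (x,t_0)\notin\mathcal G.\end{cases}$$ For $J\subset[0,+\infty)$ let $$U^J(T)(x)=\sup_{\tau}\mathbb E^x\big[e^{-r(\tau\wedge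 T)}g(X_{\tau\wedge T})\big],$$ the supremum over all $(\mathcal F_t)$-stopping times $\tau$ with values in $J\cup\{+\infty\}$. Define the immediate exercise region $$F^{\mathcal I,T}=\Big\{(x,t): x\in\mathbb R^d,\ 0\le t<+\infty,\ t\le T,\ \sup_{\mathcal G}V^{\mathcal I}_{\mathcal G}(x,t)\le g(x)\Big\},$$ where $\mathcal G$ runs through the measurable subsets of $\{(y,u)\in\mathbb R^d\times[0,+\infty): u\le T\}$. **Theorem (Optimality of the immediate exercise region).** 1. If $T<+\infty$, then for all $x\in\mathbb R^d$ $$V^{\mathcal I}_{F^{\mathcal I,T}}(x,0)=\sup\big\{\mathbb E^x[e^{-r\tau}g(X_\tau)]:\ \tau \text{ a stopping time with values in } (\mathcal I\cap[0,T])\cup\{+\infty\}\big\},$$ and if moreover $T\in\mathcal I$, then $V^{\mathcal I}_{F^{\mathcal I,T}}(x,0)=U^{\mathcal I}(T)(x)$ for all $x\in\mathbb R^d$. 2. If $T=+\infty$, then $V^{\mathcal I}_{F^{\mathcal I,+\infty}}(x,0)=U^{\mathcal I}(+\infty)(x)$ for every $x\in\mathbb R^d$ such that $\sup_{t\in\mathcal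 I}e^{-rt}g(X_t)$ is $\mathbb P^x$-integrable and $\mathbb P^x$-almost surely $e^{-rt}g(X_t)\to0$ as $t\to\infty$ in $\mathcal I$. (Both conditions hold for every $x$ if $f\ge 0$, since then $0\le g\le K\vee 0$.) -/

import Mathlib

open MeasureTheory ProbabilityTheory Filter Topology
open scoped NNReal ENNReal ZeroAtInfty

/-- A homogeneous transition function: Markov kernels satisfying the Chapman--Kolmogorov equations. -/
structure IsTransitionFunction {E : Type*} [MeasurableSpace E] (κ : ℝ≥0 → Kernel E E) :
    Prop where
  markov : ∀ t, IsMarkovKernel (κ t)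
  comp : ∀ s t, κ (s + t) = κ t ∘ₖ κ s

/-- A transition function is Feller when it acts on the continuous functions vanishing at infinity
and does so strongly continuously at time `0` (in particular it is the identity there, as `𝓝 0`
contains the point `0`). -/
def IsFellerTransition {E : Type*} [TopologicalSpace E] [MeasurableSpace E]
    (κ : ℝ≥0 → Kernel E E) : Prop :=
  ∃ S : ℝ≥0 → C₀(E, ℝ) → C₀(E, ℝ),
    (∀ t φ x, S t φ x = ∫ y, φ y ∂(κ t x)) ∧ ∀ φ, Tendsto (fun t => S t φ) (𝓝 0) (𝓝 φ)

/-- `Y` is, under the probability measure `μ`, a homogeneous Markov process with respect to the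
filtration `ℱ`, with transition function `κ` and initial law `δ_x`. -/
structure IsMarkovProcessFrom {E Ω : Type*} [MeasurableSpace E] {mΩ : MeasurableSpace Ω}
    (ℱ : Filtration ℝ≥0 mΩ) (Y : ℝ≥0 → Ω → E) (κ : ℝ≥0 → Kernel E E) (x : E)
    (μ : Measure Ω) : Prop where
  isProbability : IsProbabilityMeasure μ
  adapted : ∀ t, Measurable[ℱ t] (Y t)
  initial : μ.map (Y 0) = Measure.dirac x
  markov : ∀ (s t : ℝ≥0) (A : Set E), MeasurableSet A →
    μ⟦Y (s + t) ⁻¹' A | ℱ s⟧ =ᵐ[μ] fun ω => (κ t (Y s ω)).real A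

/-- A `d`-dimensional Feller basket on `Ω`, together with an associated family of risk-neutral
measures and discount rate: the processes `X x` of logarithmic prices started at `x` are Markov,
for the physical measure with a Feller transition function `P`, and for the risk-neutral measure
`RN x` with a transition function `Q`; under `RN x` the discounted price of each asset is a
martingale; and the two laws of the path of `X x` up to any finite time are equivalent. -/
structure FellerBasket (d : ℕ) (Ω : Type*) [mΩ : MeasurableSpace Ω] where
  /-- the filtration -/
  ℱ : Filtration ℝ≥0 mΩ
  /-- the logarithmic price vector at time `t` when started at `x` -/
  X : (Fin d → ℝ) → ℝ≥0 → Ω → (Fin d → ℝ)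
  /-- the physical transition function -/
  P : ℝ≥0 → Kernel (Fin d → ℝ) (Fin d → ℝ)
  /-- the risk-neutral transition function -/
  Q : ℝ≥0 → Kernel (Fin d → ℝ) (Fin d → ℝ)
  /-- the physical measures -/
  phys : (Fin d → ℝ) → Measure Ω
  /-- the risk-neutral measures -/
  RN : (Fin d → ℝ) → Measure Ω
  /-- the discount rate -/
  r : ℝ
  r_pos : 0 < r
  transition_P : IsTransitionFunction P
  feller_P : IsFellerTransition P
  markov_phys : ∀ x, IsMarkovProcessFrom ℱ (X x) P x (phys x)
  transition_Q : IsTransitionFunction Q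
  markov_riskNeutral : ∀ x, IsMarkovProcessFrom ℱ (X x) Q x (RN x)
  martingale : ∀ x i, Martingale (fun (t : ℝ≥0) ω => Real.exp (X x t ω i - r * t)) ℱ (RN x)
  equivalent : ∀ (x : Fin d → ℝ) (T : ℝ≥0),
    (phys x).map (fun ω (t : Set.Iic T) => X x t ω) ≪
        (RN x).map (fun ω (t : Set.Iic T) => X x t ω) ∧
      (RN x).map (fun ω (t : Set.Iic T) => X x t ω) ≪
        (phys x).map (fun ω (t : Set.Iic T) => X x t ω)

namespace FellerBasket

variable {d : ℕ} {Ω : Type*} [MeasurableSpace Ω]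

/-- `e^{-rτ} g(X_τ)` at the path `ω` of the space-time process that is started in the point `x` at
the calendar time `t₀` (so that the position at the calendar time `t ≥ t₀` is that of `X x` at the
elapsed time `t - t₀`); it is `0` when `τ = ∞`. -/
noncomputable def discountedPayoff (B : FellerBasket d Ω) (g : (Fin d → ℝ) → ℝ)
    (x : Fin d → ℝ) (t₀ : ℝ≥0) (τ : WithTop ℝ≥0) (ω : Ω) : ℝ≥0∞ :=
  match τ with
  | ⊤ => 0
  | (t : ℝ≥0) => ENNReal.ofReal (Real.exp (-B.r * t) * g (B.X x (t - t₀) ω))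

/-- First calendar time among the exercise times `t ≥ t₀` in `I` at which the space-time process
started in `(x, t₀)` is in `G`; it is `∞` when there is none. -/
noncomputable def entryTime (B : FellerBasket d Ω) (I : Set ℝ≥0)
    (G : Set ((Fin d → ℝ) × ℝ≥0)) (x : Fin d → ℝ) (t₀ : ℝ≥0) (ω : Ω) : WithTop ℝ≥0 :=
  ⨅ t ∈ {t : ℝ≥0 | t ∈ I ∧ t₀ ≤ t ∧ (B.X x (t - t₀) ω, t) ∈ G}, (t : WithTop ℝ≥0)

open Classical in
/-- The expected payoff `V_G^I(x, t₀)`, discounted to the time `t₀`, of exercising at the first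
entry into the space-time region `G`. -/
noncomputable def hittingValue (B : FellerBasket d Ω) (g : (Fin d → ℝ) → ℝ) (I : Set ℝ≥0)
    (G : Set ((Fin d → ℝ) × ℝ≥0)) (x : Fin d → ℝ) (t₀ : ℝ≥0) : ℝ≥0∞ :=
  if (x, t₀) ∈ G then ENNReal.ofReal (g x)
  else ENNReal.ofReal (Real.exp (B.r * t₀)) *
    ∫⁻ ω, B.discountedPayoff g x t₀ (B.entryTime I G x t₀ ω) ω ∂(B.RN x)

/-- The immediate exercise region `F^{I,T}`: the points of space-time, up to time `T`, at which no
measurable region `G` up to time `T` has a hitting value that exceeds the immediate payoff. -/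
def exerciseRegion (B : FellerBasket d Ω) (g : (Fin d → ℝ) → ℝ) (I : Set ℝ≥0)
    (T : WithTop ℝ≥0) : Set ((Fin d → ℝ) × ℝ≥0) :=
  {p | (p.2 : WithTop ℝ≥0) ≤ T ∧
    (⨆ G ∈ {G : Set ((Fin d → ℝ) × ℝ≥0) | MeasurableSet G ∧ ∀ q ∈ G, (q.2 : WithTop ℝ≥0) ≤ T},
      B.hittingValue g I G p.1 p.2) ≤ ENNReal.ofReal (g p.1)}

/-- The expected payoff `U^J(T)(x)` of the Bermudan option with exercise times in `J`, maturity `T`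
and log start-price `x`. -/
noncomputable def bermudanPrice (B : FellerBasket d Ω) (g : (Fin d → ℝ) → ℝ) (J : Set ℝ≥0)
    (T : WithTop ℝ≥0) (x : Fin d → ℝ) : ℝ≥0∞ :=
  ⨆ τ ∈ {τ : Ω → WithTop ℝ≥0 | IsStoppingTime B.ℱ τ ∧
      ∀ ω, τ ω = ⊤ ∨ ∃ t ∈ J, τ ω = (t : WithTop ℝ≥0)},
    ∫⁻ ω, B.discountedPayoff g x 0 (min (τ ω) T) ω ∂(B.RN x)

end FellerBasket

/-! The theorem is optimal stopping in discrete time. Let `J` be the set of exercise times up to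
`T`. It is locally finite, so it lies on a grid `s 0 = 0 < s 1 < ...` tending to infinity, along
which the log-prices form an inhomogeneous Markov chain. Grid times outside `J` get payoff zero. The
value function is the increasing limit `snellValue` of the backward-induction values `stepsValue`.

The region is identified by `iSup_hittingValue_eq`: up to the factor `e^{r s k}`, the supremum of
all hitting values from `(x, s k)` is `snellValue`. No entry rule does better
(`tsum_payoff_le_snellValue`), and each finite-horizon value is reached by some region
(`stepsValue_le_tsum_firstEntry`). Hence at an exercise time the immediate exercise region is the
set where the envelope is at most the payoff.

For optimality, the envelope equals its expected next value off that region. It is therefore bounded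
by the payoff at first entry plus a remainder on the paths that have not entered by time `n`. The
remainder is at most the expected supremum of the payoffs from time `n` on, which vanishes by
dominated convergence (`snellValue_le_tsum_firstEntry`). -/

/-! ### Optimal stopping of a Markov chain in discrete time. -/

section DiscreteTime

variable {E Ω : Type*} [MeasurableSpace E]

/-- The value, at the time `k` and in a given state, of optimally stopping a Markov chain with
transition kernels `κ` and payoffs `h` when only the times `k, …, k + n` are allowed. -/
noncomputable def stepsValue (κ : ℕ → Kernel E E) (h : ℕ → E → ℝ≥0∞) : ℕ → ℕ → E → ℝ≥0∞
  | 0, k => h k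
  | n + 1, k => fun y => max (h k y) (∫⁻ z, stepsValue κ h n (k + 1) z ∂(κ k y))

/-- The value, at the time `k` and in a given state, of optimally stopping a Markov chain with
transition kernels `κ` and payoffs `h`. -/
noncomputable def snellValue (κ : ℕ → Kernel E E) (h : ℕ → E → ℝ≥0∞) (k : ℕ) (y : E) : ℝ≥0∞ :=
  ⨆ n, stepsValue κ h n k y

/-- The Markov property of `Y` from the time `k₀` on, with respect to the filtration `𝒢` and the
transition kernels `κ`, in integrated form. -/
def IsMarkovChainFrom {m : MeasurableSpace Ω} (𝒢 : Filtration ℕ m) (Y : ℕ → Ω → E)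
    (κ : ℕ → Kernel E E) (μ : Measure Ω) (k₀ : ℕ) : Prop :=
  ∀ k, k₀ ≤ k → ∀ A, MeasurableSet[𝒢 k] A → ∀ φ : E → ℝ≥0∞, Measurable φ →
    ∫⁻ ω in A, φ (Y (k + 1) ω) ∂μ = ∫⁻ ω in A, ∫⁻ z, φ z ∂(κ k (Y k ω)) ∂μ

/-- The event that a process enters the sets `D` at the time `k` and not earlier, starting from the
time `k₀`. -/
def firstEntry (Y : ℕ → Ω → E) (D : ℕ → Set E) (k₀ k : ℕ) : Set Ω :=
  {ω | (∀ j, k₀ ≤ j → j < k → Y j ω ∉ D j) ∧ k₀ ≤ k ∧ Y k ω ∈ D k}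

variable {κ : ℕ → Kernel E E} {h : ℕ → E → ℝ≥0∞}

lemma measurable_stepsValue (hh : ∀ k, Measurable (h k)) (n k : ℕ) :
    Measurable (stepsValue κ h n k) := by
  induction n generalizing k with
  | zero => exact hh k
  | succ n ih => exact (hh k).max (ih (k + 1)).lintegral_kernel

lemma measurable_snellValue (hh : ∀ k, Measurable (h k)) (k : ℕ) :
    Measurable (snellValue κ h k) :=
  Measurable.iSup fun n => measurable_stepsValue hh n k

lemma stepsValue_le_succ (n k : ℕ) (y : E) :
    stepsValue κ h n k y ≤ stepsValue κ h (n + 1) k y := by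
  induction n generalizing k y with
  | zero => exact le_max_left _ _
  | succ n ih => exact max_le_max le_rfl (lintegral_mono fun z => ih (k + 1) z)

lemma monotone_stepsValue (k : ℕ) : Monotone fun n => stepsValue κ h n k :=
  monotone_nat_of_le_succ fun n y => stepsValue_le_succ n k y

/-- The Bellman equation passes to the infinite horizon because the finite-horizon values increase
with `n`, so monotone convergence moves the supremum through the kernel. With values in `[0, ∞]` no
integrability is needed. -/
lemma snellValue_eq_max (hh : ∀ k, Measurable (h k)) (k : ℕ) (y : E) :
    snellValue κ h k y = max (h k y) (∫⁻ z, snellValue κ h (k + 1) z ∂(κ k y)) := by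
  have h1 : ∫⁻ z, snellValue κ h (k + 1) z ∂(κ k y)
      = ⨆ n, ∫⁻ z, stepsValue κ h n (k + 1) z ∂(κ k y) :=
    lintegral_iSup (fun n => measurable_stepsValue hh n (k + 1)) (monotone_stepsValue (k + 1))
  rw [h1]
  apply le_antisymm
  · refine iSup_le fun n => ?_
    cases n with
    | zero => exact le_max_left _ _
    | succ n => exact max_le_max le_rfl (le_iSup (fun n => ∫⁻ z, stepsValue κ h n (k + 1) z ∂(κ k y)) n)
  · refine max_le (le_iSup (fun n => stepsValue κ h n k y) 0) (iSup_le fun n => ?_)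
    exact (le_max_right _ _).trans (le_iSup (fun n => stepsValue κ h n k y) (n + 1))

lemma payoff_le_snellValue (k : ℕ) (y : E) : h k y ≤ snellValue κ h k y :=
  le_iSup (fun n => stepsValue κ h n k y) 0

variable {m : MeasurableSpace Ω} {𝒢 : Filtration ℕ m} {Y : ℕ → Ω → E} {μ : Measure Ω} {k₀ : ℕ}

lemma measurableSet_firstEntry (hY : ∀ k, Measurable[𝒢 k] (Y k)) {D : ℕ → Set E}
    (hD : ∀ k, MeasurableSet (D k)) (k : ℕ) :
    MeasurableSet[𝒢 k] (firstEntry Y D k₀ k) := by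
  have h1 : firstEntry Y D k₀ k
      = (⋂ j, ⋂ (_ : k₀ ≤ j), ⋂ (_ : j < k), (Y j ⁻¹' D j)ᶜ) ∩ ({ω | k₀ ≤ k} ∩ Y k ⁻¹' D k) := by
    ext ω; simp [firstEntry]
  rw [h1]
  refine MeasurableSet.inter ?_ (MeasurableSet.inter (MeasurableSet.const _) (hY k (hD k)))
  refine MeasurableSet.iInter fun j => MeasurableSet.iInter fun _ => MeasurableSet.iInter fun hj => ?_
  exact 𝒢.mono hj.le _ (hY j (hD j)).compl

omit [MeasurableSpace E] in
lemma pairwise_disjoint_firstEntry (D : ℕ → Set E) :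
    Pairwise (Function.onFun Disjoint (firstEntry Y D k₀)) := by
  have key : ∀ i j, i < j → Disjoint (firstEntry Y D k₀ i) (firstEntry Y D k₀ j) := by
    intro i j hij
    rw [Set.disjoint_left]
    rintro ω ⟨_, hi, hi'⟩ ⟨hj, _⟩
    exact hj i hi hij hi'
  intro i j hij
  rcases lt_or_gt_of_ne hij with h1 | h1
  · exact key i j h1
  · exact (key j i h1).symm

/-- The Snell envelope dominates the expected payoff of every stopping rule, given by the disjoint
events `S k` of stopping at the time `k`. -/
lemma tsum_payoff_le_snellValue (hh : ∀ k, Measurable (h k))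
    (hM : IsMarkovChainFrom 𝒢 Y κ μ k₀) {S : ℕ → Set Ω}
    (hS : ∀ k, MeasurableSet[𝒢 k] (S k)) (hd : Pairwise (Function.onFun Disjoint S))
    (hS₀ : ∀ k < k₀, S k = ∅) :
    ∑' k, ∫⁻ ω in S k, h k (Y k ω) ∂μ ≤ ∫⁻ ω, snellValue κ h k₀ (Y k₀ ω) ∂μ := by
  have hR : ∀ n, MeasurableSet[𝒢 n] (⋃ j < n + 1, S j)ᶜ := fun n =>
    (MeasurableSet.iUnion fun j => MeasurableSet.iUnion fun hj =>
      𝒢.mono (Nat.lt_succ_iff.1 hj) _ (hS j)).compl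
  -- Supermartingale property: the payoff collected before `k₀ + n`, plus the envelope on the event
  -- of not having stopped yet, does not increase in expectation with `n`.
  have key : ∀ n, ∑ k ∈ Finset.range (k₀ + n), ∫⁻ ω in S k, h k (Y k ω) ∂μ
      + ∫⁻ ω in (⋃ j < k₀ + n, S j)ᶜ, snellValue κ h (k₀ + n) (Y (k₀ + n) ω) ∂μ
        ≤ ∫⁻ ω, snellValue κ h k₀ (Y k₀ ω) ∂μ := by
    intro n
    induction n with
    | zero =>
      rw [Finset.sum_eq_zero, zero_add, add_zero]
      · exact setLIntegral_le_lintegral _ _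
      · intro k hk
        rw [hS₀ k (by simpa using hk)]; simp
    | succ n ih =>
      refine le_trans ?_ ih
      rw [← add_assoc, Finset.sum_range_succ, add_assoc]
      refine add_le_add le_rfl ?_
      set k := k₀ + n
      have hsub : S k ⊆ (⋃ j < k, S j)ᶜ := by
        intro ω hω
        simp only [Set.mem_compl_iff, Set.mem_iUnion, not_exists]
        intro j hj hj'
        exact Set.disjoint_left.1 (hd hj.ne) hj' hω
      have hsplit : (⋃ j < k, S j)ᶜ = S k ∪ (⋃ j < k + 1, S j)ᶜ := by
        ext ω
        constructor
        · intro hω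
          by_cases hk : ω ∈ S k
          · exact Or.inl hk
          · right
            simp only [Set.mem_compl_iff, Set.mem_iUnion, not_exists] at hω ⊢
            intro j hj hj'
            rcases Nat.lt_succ_iff_lt_or_eq.1 hj with h1 | h1
            · exact hω j h1 hj'
            · exact hk (h1 ▸ hj')
        · rintro (hω | hω)
          · exact hsub hω
          · simp only [Set.mem_compl_iff, Set.mem_iUnion, not_exists] at hω ⊢
            exact fun j hj => hω j (by omega)
      have hdis : Disjoint (S k) (⋃ j < k + 1, S j)ᶜ := by
        rw [Set.disjoint_left]
        intro ω hω h1
        exact h1 (Set.mem_iUnion₂.2 ⟨k, Nat.lt_succ_self k, hω⟩)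
      rw [hsplit, lintegral_union (𝒢.le k _ (hR k)) hdis,
        hM k (Nat.le_add_right _ _) _ (hR k) _ (measurable_snellValue hh (k + 1))]
      refine add_le_add (lintegral_mono fun ω => payoff_le_snellValue _ _)
        (lintegral_mono fun ω => ?_)
      rw [snellValue_eq_max hh k]
      exact le_max_right _ _
  refine ENNReal.tsum_le_of_sum_range_le fun n => ?_
  refine le_trans ?_ (key n)
  refine le_trans (Finset.sum_le_sum_of_subset (Finset.range_subset_range.2 (by omega))) le_self_add

/-- Verification: if `w` is at most the payoff on `D` and at most its expectation at the next time
outside of `D`, then it is bounded by the expected payoff at the first entry into `D`, up to the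
contribution of the paths that do not enter before the time `k₀ + n`. -/
lemma lintegral_le_firstEntry_add (hY : ∀ k, Measurable[𝒢 k] (Y k))
    (hM : IsMarkovChainFrom 𝒢 Y κ μ k₀) {D : ℕ → Set E} (hD : ∀ k, MeasurableSet (D k))
    {w : ℕ → E → ℝ≥0∞} (hw : ∀ k, Measurable (w k)) (n : ℕ)
    (hw₁ : ∀ k < k₀ + n, ∀ y ∈ D k, w k y ≤ h k y)
    (hw₂ : ∀ k < k₀ + n, ∀ y ∉ D k, w k y ≤ ∫⁻ z, w (k + 1) z ∂(κ k y)) :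
    ∫⁻ ω, w k₀ (Y k₀ ω) ∂μ ≤ ∑ k ∈ Finset.range (k₀ + n),
      ∫⁻ ω in firstEntry Y D k₀ k, h k (Y k ω) ∂μ
        + ∫⁻ ω in {ω | ∀ j, k₀ ≤ j → j < k₀ + n → Y j ω ∉ D j}, w (k₀ + n) (Y (k₀ + n) ω) ∂μ := by
  induction n with
  | zero =>
    have : {ω | ∀ j, k₀ ≤ j → j < k₀ + 0 → Y j ω ∉ D j} = Set.univ := by
      ext ω; simp; intro j h1 h2; omega
    rw [this, Measure.restrict_univ]
    exact le_add_self
  | succ n ih =>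
    refine (ih (fun k hk => hw₁ k (by omega)) (fun k hk => hw₂ k (by omega))).trans ?_
    rw [← add_assoc k₀, Finset.sum_range_succ, add_assoc]
    refine add_le_add le_rfl ?_
    have hk : k₀ + n < k₀ + (n + 1) := by omega
    have hk' : k₀ ≤ k₀ + n := by omega
    generalize k₀ + n = k at hk hk' ⊢
    have hR : MeasurableSet[𝒢 k] {ω | ∀ j, k₀ ≤ j → j < k + 1 → Y j ω ∉ D j} := by
      simp only [Set.ofPred_forall]
      exact MeasurableSet.iInter fun j => MeasurableSet.iInter fun _ =>
        MeasurableSet.iInter fun hj => 𝒢.mono (Nat.lt_succ_iff.1 hj) _ (hY j (hD j)).compl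
    have hsplit : {ω | ∀ j, k₀ ≤ j → j < k → Y j ω ∉ D j}
        = firstEntry Y D k₀ k ∪ {ω | ∀ j, k₀ ≤ j → j < k + 1 → Y j ω ∉ D j} := by
      ext ω
      constructor
      · intro hω
        by_cases h1 : Y k ω ∈ D k
        · exact Or.inl ⟨hω, hk', h1⟩
        · refine Or.inr fun j hj hj' => ?_
          rcases Nat.lt_succ_iff_lt_or_eq.1 hj' with h2 | h2
          · exact hω j hj h2
          · exact h2 ▸ h1
      · rintro (hω | hω)
        · exact hω.1
        · exact fun j hj hj' => hω j hj (by omega)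
    rw [hsplit, hM k hk' _ hR _ (hw (k + 1))]
    refine (lintegral_union_le _ _ _).trans (add_le_add ?_ ?_)
    · exact setLIntegral_mono' (𝒢.le k _ (measurableSet_firstEntry hY hD k))
        fun ω hω => hw₁ k hk _ hω.2.2
    · exact setLIntegral_mono' (𝒢.le k _ hR)
        fun ω hω => hw₂ k hk _ (hω k hk' (Nat.lt_succ_self k))

/-- The Snell envelope is at most the expectation of the largest future payoff. -/
lemma lintegral_snellValue_le (hh : ∀ k, Measurable (h k)) (hY : ∀ k, Measurable[𝒢 k] (Y k))
    (hM : IsMarkovChainFrom 𝒢 Y κ μ k₀) {k : ℕ} (hk : k₀ ≤ k) :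
    ∫⁻ ω, snellValue κ h k (Y k ω) ∂μ ≤ ∫⁻ ω, ⨆ j ≥ k, h j (Y j ω) ∂μ := by
  -- The event `A` has to be arbitrary for the induction: it is cut by whether stopping at `k` is
  -- optimal, and the Markov property moves the continuation part to time `k + 1`.
  have key : ∀ n k, k₀ ≤ k → ∀ A, MeasurableSet[𝒢 k] A →
      ∫⁻ ω in A, stepsValue κ h n k (Y k ω) ∂μ ≤ ∫⁻ ω in A, ⨆ j ≥ k, h j (Y j ω) ∂μ := by
    intro n
    induction n with
    | zero =>
      exact fun k _ A _ => lintegral_mono fun ω =>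
        le_iSup₂ (f := fun j (_ : j ≥ k) => h j (Y j ω)) k le_rfl
    | succ n ih =>
      intro k hk A hA
      have hcont : Measurable fun y => ∫⁻ z, stepsValue κ h n (k + 1) z ∂(κ k y) :=
        (measurable_stepsValue hh n (k + 1)).lintegral_kernel
      have hB : MeasurableSet[𝒢 k]
          (Y k ⁻¹' {y | ∫⁻ z, stepsValue κ h n (k + 1) z ∂(κ k y) ≤ h k y}) :=
        hY k (measurableSet_le hcont (hh k))
      set B := Y k ⁻¹' {y | ∫⁻ z, stepsValue κ h n (k + 1) z ∂(κ k y) ≤ h k y}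
      rw [← lintegral_inter_add_sdiff _ A (𝒢.le k _ hB),
        ← lintegral_inter_add_sdiff (fun ω => ⨆ j ≥ k, h j (Y j ω)) A (𝒢.le k _ hB)]
      refine add_le_add ?_ ?_
      · refine setLIntegral_mono' (𝒢.le k _ (hA.inter hB)) fun ω hω => ?_
        exact (max_eq_left (a := h k (Y k ω)) hω.2).le.trans
          (le_iSup₂ (f := fun j (_ : j ≥ k) => h j (Y j ω)) k le_rfl)
      · calc ∫⁻ ω in A \ B, stepsValue κ h (n + 1) k (Y k ω) ∂μ
            ≤ ∫⁻ ω in A \ B, ∫⁻ z, stepsValue κ h n (k + 1) z ∂(κ k (Y k ω)) ∂μ :=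
              setLIntegral_mono' (𝒢.le k _ (hA.diff hB)) fun ω hω =>
                (max_eq_right (a := h k (Y k ω)) (not_le.1 hω.2).le).le
          _ = ∫⁻ ω in A \ B, stepsValue κ h n (k + 1) (Y (k + 1) ω) ∂μ :=
              (hM k hk _ (hA.diff hB) _ (measurable_stepsValue hh n (k + 1))).symm
          _ ≤ ∫⁻ ω in A \ B, ⨆ j ≥ k + 1, h j (Y j ω) ∂μ :=
              ih (k + 1) (by omega) _ (𝒢.mono (Nat.le_succ k) _ (hA.diff hB))
          _ ≤ _ := lintegral_mono fun ω =>
              biSup_mono (f := fun j => h j (Y j ω)) fun j hj => by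
                have : j ≥ k + 1 := hj
                change k ≤ j
                omega
  have hYm : ∀ k, Measurable (Y k) := fun k => (hY k).mono (𝒢.le k) le_rfl
  have h1 : ∫⁻ ω, snellValue κ h k (Y k ω) ∂μ = ⨆ n, ∫⁻ ω, stepsValue κ h n k (Y k ω) ∂μ :=
    lintegral_iSup (fun n => (measurable_stepsValue hh n k).comp (hYm k))
      fun _ _ hij ω => monotone_stepsValue k hij (Y k ω)
  rw [h1]
  refine iSup_le fun n => ?_
  simpa using key n k hk Set.univ MeasurableSet.univ

/-- The first entry into sets `D` which lie below the level where stopping is optimal achieves the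
Snell envelope, if the future payoffs are dominated and vanish in the limit. -/
lemma snellValue_le_tsum_firstEntry (hh : ∀ k, Measurable (h k))
    (hY : ∀ k, Measurable[𝒢 k] (Y k)) (hM : IsMarkovChainFrom 𝒢 Y κ μ k₀) {D : ℕ → Set E}
    (hD : ∀ k, MeasurableSet (D k)) (hD₁ : ∀ k, ∀ y ∈ D k, snellValue κ h k y ≤ h k y)
    (hD₂ : ∀ k, ∀ y ∉ D k, h k y < snellValue κ h k y ∨ h k y = 0)
    (hfin : ∫⁻ ω, ⨆ j, h j (Y j ω) ∂μ ≠ ∞)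
    (hlim : ∀ᵐ ω ∂μ, Tendsto (fun j => h j (Y j ω)) atTop (𝓝 0)) :
    ∫⁻ ω, snellValue κ h k₀ (Y k₀ ω) ∂μ
      ≤ ∑' k, ∫⁻ ω in firstEntry Y D k₀ k, h k (Y k ω) ∂μ := by
  have hYm : ∀ k, Measurable (Y k) := fun k => (hY k).mono (𝒢.le k) le_rfl
  have hbound : ∀ n, ∫⁻ ω, snellValue κ h k₀ (Y k₀ ω) ∂μ
      ≤ ∑' k, ∫⁻ ω in firstEntry Y D k₀ k, h k (Y k ω) ∂μ
        + ∫⁻ ω, ⨆ j ≥ k₀ + n, h j (Y j ω) ∂μ := by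
    intro n
    refine (lintegral_le_firstEntry_add (h := h) hY hM hD (measurable_snellValue hh) n
      (fun k _ => hD₁ k) ?_).trans (add_le_add (ENNReal.sum_le_tsum _) ?_)
    -- Off `D` the maximum in the Bellman equation is the continuation value. The alternative of
    -- zero payoff is meant for grid times at which exercise is not allowed.
    · intro k _ y hy
      have h1 := snellValue_eq_max (κ := κ) hh k y
      rcases hD₂ k y hy with h2 | h2
      · rcases max_choice (h k y) (∫⁻ z, snellValue κ h (k + 1) z ∂(κ k y)) with h3 | h3
        · exact absurd (h1.trans h3) h2.ne'
        · exact (h1.trans h3).le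
      · rw [h1, h2]; simp
    · exact (setLIntegral_le_lintegral _ _).trans
        (lintegral_snellValue_le hh hY hM (Nat.le_add_right _ _))
  have htail : Tendsto (fun n => ∫⁻ ω, ⨆ j ≥ k₀ + n, h j (Y j ω) ∂μ) atTop (𝓝 0) := by
    have := tendsto_lintegral_of_dominated_convergence (μ := μ)
      (F := fun n ω => ⨆ j ≥ k₀ + n, h j (Y j ω)) (f := fun _ => 0)
      (fun ω => ⨆ j, h j (Y j ω))
      (fun n => Measurable.iSup fun j => Measurable.iSup fun _ => (hh j).comp (hYm j))
      (fun n => Eventually.of_forall fun ω => iSup_mono fun j => iSup_le fun _ => le_rfl) hfin ?_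
    · simpa using this
    · filter_upwards [hlim] with ω hω
      rw [ENNReal.tendsto_atTop_zero] at hω ⊢
      intro ε hε
      obtain ⟨N, hN⟩ := hω ε hε
      exact ⟨N, fun n hn => iSup₂_le fun j hj => hN j (by omega)⟩
  have h2 := ge_of_tendsto' (tendsto_const_nhds.add htail) hbound
  simpa using h2

/-- The first entry into the optimal stopping region with finite horizon `k₀ + n` achieves the value
of stopping at the times `k₀, …, k₀ + n`. -/
lemma stepsValue_le_tsum_firstEntry (hh : ∀ k, Measurable (h k))
    (hY : ∀ k, Measurable[𝒢 k] (Y k)) (hM : IsMarkovChainFrom 𝒢 Y κ μ k₀) (n : ℕ) {p : ℕ → Prop}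
    (hp : ∀ k, ¬ p k → ∀ y, h k y = 0) :
    ∫⁻ ω, stepsValue κ h n k₀ (Y k₀ ω) ∂μ
      ≤ ∑' k, ∫⁻ ω in firstEntry Y
        (fun k => {y | p k ∧ stepsValue κ h (k₀ + n - k) k y ≤ h k y}) k₀ k, h k (Y k ω) ∂μ := by
  have hYm : ∀ k, Measurable (Y k) := fun k => (hY k).mono (𝒢.le k) le_rfl
  set D : ℕ → Set E := fun k => {y | p k ∧ stepsValue κ h (k₀ + n - k) k y ≤ h k y}
  have hD : ∀ k, MeasurableSet (D k) := fun k =>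
    (MeasurableSet.const (p k)).inter (measurableSet_le (measurable_stepsValue hh _ k) (hh k))
  -- The comparison function at time `k` has the remaining horizon `k₀ + n - k`, hence reduces to
  -- the payoff itself at time `k₀ + n`.
  have h1 := lintegral_le_firstEntry_add (h := h) hY hM hD
    (w := fun k => stepsValue κ h (k₀ + n - k) k) (fun k => measurable_stepsValue hh _ k) n
    (fun k _ y hy => hy.2) ?_
  · have h2 : k₀ + n - k₀ = n := by omega
    simp only [h2, Nat.sub_self] at h1
    refine h1.trans (le_trans ?_ (ENNReal.sum_le_tsum (Finset.range (k₀ + n + 1))))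
    rw [Finset.sum_range_succ]
    refine add_le_add le_rfl ?_
    -- If stopping is allowed at the last time, the paths that have not entered before enter exactly
    -- then; otherwise the payoff there is zero.
    by_cases hpk : p (k₀ + n)
    · refine lintegral_mono' (Measure.restrict_mono ?_ le_rfl) le_rfl
      intro ω hω
      refine ⟨hω, Nat.le_add_right _ _, hpk, ?_⟩
      rw [Nat.sub_self]; exact le_rfl
    · simp [stepsValue, hp _ hpk]
  · intro k hk y hy
    obtain ⟨l, hl⟩ : ∃ l, k₀ + n - k = l + 1 := ⟨k₀ + n - k - 1, by omega⟩
    have hl' : k₀ + n - (k + 1) = l := by omega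
    simp only [D, hl, Set.mem_ofPred_eq, not_and_or, not_le] at hy
    simp only [hl, hl']
    rcases hy with hy | hy
    · simp [stepsValue, hp k hy]
    · rcases max_choice (h k y) (∫⁻ z, stepsValue κ h l (k + 1) z ∂(κ k y)) with h3 | h3
      · exact absurd h3 hy.ne'
      · exact h3.le

end DiscreteTime

/-! ### Time grids and the integrated Markov property. -/

/-- A locally finite set of nonnegative reals is contained in the range of a strictly increasing
unbounded sequence that starts in `0`. -/
lemma exists_strictMono_grid {J : Set ℝ≥0} (hJ : ∀ t, (J ∩ Set.Iic t).Finite) :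
    ∃ s : ℕ → ℝ≥0, StrictMono s ∧ s 0 = 0 ∧ J ⊆ Set.range s ∧ Tendsto s atTop atTop := by
  classical
  -- Adjoining the natural numbers keeps the set locally finite and makes it unbounded with least
  -- element `0`, hence order isomorphic to `ℕ`, even if `J` is finite.
  set L : Set ℝ≥0 := J ∪ Set.range (Nat.cast : ℕ → ℝ≥0) with hLdef
  have hL : ∀ t, (L ∩ Set.Iic t).Finite := by
    intro t
    rw [hLdef, Set.union_inter_distrib_right]
    refine (hJ t).union (((Set.finite_Iic ⌊t⌋₊).image (Nat.cast : ℕ → ℝ≥0)).subset ?_)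
    rintro _ ⟨⟨n, rfl⟩, hn⟩
    exact ⟨n, Nat.le_floor hn, rfl⟩
  let _ : LocallyFiniteOrder L := LocallyFiniteOrder.ofFiniteIcc fun a b => by
    refine Set.Finite.of_finite_image (f := Subtype.val) ((hL b).subset ?_)
      Subtype.val_injective.injOn
    rintro _ ⟨c, hc, rfl⟩
    exact ⟨c.2, hc.2⟩
  let _ : SuccOrder L := LinearLocallyFiniteOrder.succOrder L
  let _ : PredOrder L := LinearLocallyFiniteOrder.predOrder L
  let _ : OrderBot L := { bot := ⟨0, Or.inr ⟨0, by simp⟩⟩, bot_le := fun a => show (0 : ℝ≥0) ≤ a from zero_le }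
  have _ : NoMaxOrder L := ⟨fun a => by
    obtain ⟨n, hn⟩ := exists_nat_gt (a : ℝ≥0)
    exact ⟨⟨n, Or.inr ⟨n, rfl⟩⟩, hn⟩⟩
  let e : L ≃o ℕ := orderIsoNatOfLinearSuccPredArch
  have hmem : ∀ t ∈ L, ∃ n, (e.symm n : ℝ≥0) = t := fun t ht => ⟨e ⟨t, ht⟩, by simp⟩
  have hmono : StrictMono fun n => (e.symm n : ℝ≥0) := fun _ _ h => e.symm.strictMono h
  refine ⟨fun n => e.symm n, hmono, ?_, ?_, ?_⟩
  · have : e.symm 0 = ⊥ := e.symm.map_bot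
    simp only [this]; rfl
  · exact fun t ht => hmem t (Or.inl ht)
  · refine tendsto_atTop_atTop_of_monotone hmono.monotone fun b => ?_
    obtain ⟨n, hn⟩ := exists_nat_ge b
    obtain ⟨k, hk⟩ := hmem n (Or.inr ⟨n, rfl⟩)
    exact ⟨k, hn.trans hk.ge⟩

/-- The Markov property in integrated form. -/
lemma IsMarkovProcessFrom.setLIntegral_eq {E Ω : Type*} [MeasurableSpace E]
    {mΩ : MeasurableSpace Ω} {ℱ : Filtration ℝ≥0 mΩ} {Y : ℝ≥0 → Ω → E} {κ : ℝ≥0 → Kernel E E}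
    {x : E} {μ : Measure Ω} (H : IsMarkovProcessFrom ℱ Y κ x μ) (s t : ℝ≥0) [IsMarkovKernel (κ t)]
    {A : Set Ω} (hA : MeasurableSet[ℱ s] A) {φ : E → ℝ≥0∞} (hφ : Measurable φ) :
    ∫⁻ ω in A, φ (Y (s + t) ω) ∂μ = ∫⁻ ω in A, ∫⁻ z, φ z ∂(κ t (Y s ω)) ∂μ := by
  have := H.isProbability
  have hY : ∀ t, Measurable (Y t) := fun t => (H.adapted t).mono (ℱ.le t) le_rfl
  -- Both sides integrate `φ` against a measure on `E`, so it suffices to compare these measures on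
  -- sets, where the conditional probabilities apply.
  have key : (μ.restrict A).map (Y (s + t)) = ((μ.restrict A).map (Y s)).bind (κ t) := by
    ext C hC
    have hC' : MeasurableSet (Y (s + t) ⁻¹' C) := hY _ hC
    rw [Measure.map_apply (hY _) hC, Measure.bind_apply hC (κ t).aemeasurable,
      lintegral_map ((κ t).measurable_coe hC) (hY s), Measure.restrict_apply hC']
    have h1 : ∫ ω in A, (κ t (Y s ω)).real C ∂μ = μ.real (Y (s + t) ⁻¹' C ∩ A) := by
      rw [← setIntegral_congr_ae (ℱ.le s _ hA) ((H.markov s t C hC).mono fun ω h _ => h),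
        setIntegral_condExp (ℱ.le s) ((integrable_const 1).indicator hC') hA,
        integral_indicator hC', Measure.restrict_restrict hC']
      simp
    have h2 : ∫ ω in A, (κ t (Y s ω)).real C ∂μ
        = (∫⁻ ω in A, κ t (Y s ω) C ∂μ).toReal :=
      integral_toReal (((κ t).measurable_coe hC).comp (hY s)).aemeasurable
        (Eventually.of_forall fun ω => measure_lt_top _ _)
    have h3 : ∫⁻ ω in A, κ t (Y s ω) C ∂μ ≠ ∞ := by
      refine ((lintegral_mono fun ω => prob_le_one).trans_lt ?_).ne
      simp
    rw [← ENNReal.toReal_eq_toReal_iff' (measure_ne_top _ _) h3, ← h2, h1]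
    rfl
  have h1 := congrArg (fun ν => ∫⁻ z, φ z ∂ν) key
  rwa [lintegral_map hφ (hY _), Measure.lintegral_bind (κ t).aemeasurable hφ.aemeasurable,
    lintegral_map hφ.lintegral_kernel (hY s)] at h1

/-! ### The risk-neutral process sampled along a grid. -/

namespace FellerBasket

variable {d : ℕ} {Ω : Type*} [MeasurableSpace Ω] (B : FellerBasket d Ω)

open Classical in
/-- The discounted payoff at the times `s k`, which is `0` if this is not an exercise time. -/
noncomputable def gridPayoff (g : (Fin d → ℝ) → ℝ) (s : ℕ → ℝ≥0) (J : Set ℝ≥0) (k : ℕ)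
    (y : Fin d → ℝ) : ℝ≥0∞ :=
  if s k ∈ J then ENNReal.ofReal (Real.exp (-B.r * s k) * g y) else 0

/-- The risk-neutral transition kernels between successive times of a grid. -/
def gridKernel (s : ℕ → ℝ≥0) (k : ℕ) : Kernel (Fin d → ℝ) (Fin d → ℝ) :=
  B.Q (s (k + 1) - s k)

/-- The log-price at the calendar time `s k`, when started in `x` at the calendar time `s k₀`. -/
def gridPath (s : ℕ → ℝ≥0) (x : Fin d → ℝ) (k₀ k : ℕ) (ω : Ω) : Fin d → ℝ :=
  B.X x (s k - s k₀) ω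

/-- The filtration along a grid, in elapsed time since `s k₀`. -/
def gridFiltration {s : ℕ → ℝ≥0} (hs : StrictMono s) (k₀ : ℕ) : Filtration ℕ ‹MeasurableSpace Ω› where
  seq k := B.ℱ (s k - s k₀)
  mono' _ _ h := B.ℱ.mono (tsub_le_tsub_right (hs.monotone h) _)
  le' _ := B.ℱ.le _

variable {g : (Fin d → ℝ) → ℝ} {s : ℕ → ℝ≥0} {J I : Set ℝ≥0} {T : WithTop ℝ≥0}

lemma measurable_gridPayoff (hg : Measurable g) (k : ℕ) : Measurable (B.gridPayoff g s J k) := by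
  unfold gridPayoff
  split_ifs
  · exact (hg.const_mul _).ennreal_ofReal
  · exact measurable_const

lemma measurable_gridPath (hs : StrictMono s) (x : Fin d → ℝ) (k₀ k : ℕ) :
    Measurable[B.gridFiltration hs k₀ k] (B.gridPath s x k₀ k) :=
  (B.markov_riskNeutral x).adapted _

lemma measurable_X (x : Fin d → ℝ) (t : ℝ≥0) : Measurable (B.X x t) :=
  ((B.markov_riskNeutral x).adapted t).mono (B.ℱ.le t) le_rfl

/-- The kernels do not depend on `k₀`, so one envelope serves all starting times. The condition `k₀
≤ k` makes the truncated time differences add up. -/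
lemma isMarkovChainFrom_gridPath (hs : StrictMono s) (x : Fin d → ℝ) (k₀ : ℕ) :
    IsMarkovChainFrom (B.gridFiltration hs k₀) (B.gridPath s x k₀) (B.gridKernel s) (B.RN x)
      k₀ := by
  intro k hk A hA φ hφ
  have := B.transition_Q.markov (s (k + 1) - s k)
  have h1 := (B.markov_riskNeutral x).setLIntegral_eq (s k - s k₀) (s (k + 1) - s k) hA hφ
  have h2 : s k - s k₀ + (s (k + 1) - s k) = s (k + 1) - s k₀ := by
    rw [add_comm]
    exact tsub_add_tsub_cancel (hs.monotone (Nat.le_succ k)) (hs.monotone hk)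
  rw [h2] at h1
  exact h1

lemma ae_X_zero_eq (x : Fin d → ℝ) : ∀ᵐ ω ∂(B.RN x), B.X x 0 ω = x := by
  have h1 : ∀ᵐ y ∂((B.RN x).map (B.X x 0)), y = x := by
    rw [(B.markov_riskNeutral x).initial]
    exact (ae_dirac_iff (measurableSet_singleton x)).2 rfl
  exact ae_of_ae_map (B.measurable_X x 0).aemeasurable h1

lemma lintegral_gridPath_self (x : Fin d → ℝ) (k₀ : ℕ) (φ : (Fin d → ℝ) → ℝ≥0∞) :
    ∫⁻ ω, φ (B.gridPath s x k₀ k₀ ω) ∂(B.RN x) = φ x := by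
  have := (B.markov_riskNeutral x).isProbability
  have h1 : ∫⁻ ω, φ (B.gridPath s x k₀ k₀ ω) ∂(B.RN x) = ∫⁻ _, φ x ∂(B.RN x) := by
    refine lintegral_congr_ae ?_
    filter_upwards [B.ae_X_zero_eq x] with ω hω
    rw [gridPath, tsub_self, hω]
  simpa using h1

lemma discountedPayoff_top (x : Fin d → ℝ) (t₀ : ℝ≥0) (ω : Ω) :
    B.discountedPayoff g x t₀ ⊤ ω = 0 := rfl

lemma discountedPayoff_coe (x : Fin d → ℝ) (t₀ t : ℝ≥0) (ω : Ω) :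
    B.discountedPayoff g x t₀ (t : WithTop ℝ≥0) ω
      = ENNReal.ofReal (Real.exp (-B.r * t) * g (B.X x (t - t₀) ω)) := rfl

/-- The expected payoff of a random time with values in the grid. -/
lemma lintegral_discountedPayoff_eq_tsum (hg : Measurable g) (hs : StrictMono s) (x : Fin d → ℝ)
    (k₀ : ℕ) {τ : Ω → WithTop ℝ≥0}
    (hτ : ∀ ω, τ ω = ⊤ ∨ ∃ k, s k ∈ J ∧ τ ω = (s k : WithTop ℝ≥0))
    (hm : ∀ k, MeasurableSet {ω | τ ω = (s k : WithTop ℝ≥0)}) :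
    ∫⁻ ω, B.discountedPayoff g x (s k₀) (τ ω) ω ∂(B.RN x)
      = ∑' k, ∫⁻ ω in {ω | τ ω = (s k : WithTop ℝ≥0)},
          B.gridPayoff g s J k (B.gridPath s x k₀ k ω) ∂(B.RN x) := by
  have hpt : ∀ ω, B.discountedPayoff g x (s k₀) (τ ω) ω
      = ∑' k, {ω | τ ω = (s k : WithTop ℝ≥0)}.indicator
          (fun ω => B.gridPayoff g s J k (B.gridPath s x k₀ k ω)) ω := by
    intro ω
    rcases hτ ω with h1 | ⟨k, hk, h1⟩
    · rw [h1, discountedPayoff_top]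
      symm
      refine ENNReal.tsum_eq_zero.2 fun k => Set.indicator_of_notMem (fun h2 => ?_) _
      exact WithTop.coe_ne_top ((show τ ω = _ from h2).symm.trans h1)
    · rw [tsum_eq_single k, Set.indicator_of_mem (by exact h1), h1, discountedPayoff_coe, gridPayoff,
        if_pos hk, gridPath]
      intro j hj
      refine Set.indicator_of_notMem (fun h2 => hj ?_) _
      exact hs.injective (WithTop.coe_injective ((show τ ω = _ from h2).symm.trans h1))
  simp_rw [hpt]
  rw [lintegral_tsum]
  · exact tsum_congr fun k => lintegral_indicator (hm k) _
  · exact fun k => (((B.measurable_gridPayoff hg k).comp (B.measurable_X x _)).indicator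
      (hm k)).aemeasurable

/-! ### Entry times into space-time regions as first entries on the grid. -/

section EntryTime

variable {G : Set ((Fin d → ℝ) × ℝ≥0)} {x : Fin d → ℝ} {k₀ k : ℕ} {ω : Ω}

/-- The infimum runs over all of `I`, but `G` contains no point later than `T`, so only the times in
`J` count. -/
lemma entryTime_eq_of_mem_firstEntry (hs : StrictMono s) (hJs : J ⊆ Set.range s)
    (hJ : ∀ t, t ∈ J ↔ t ∈ I ∧ (t : WithTop ℝ≥0) ≤ T) (hG : ∀ q ∈ G, (q.2 : WithTop ℝ≥0) ≤ T)
    (h : ω ∈ firstEntry (B.gridPath s x k₀) (fun k => {y | s k ∈ J ∧ (y, s k) ∈ G}) k₀ k) :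
    B.entryTime I G x (s k₀) ω = (s k : WithTop ℝ≥0) := by
  obtain ⟨h1, h2, h3, h4⟩ := h
  unfold entryTime
  apply le_antisymm
  · exact iInf₂_le (f := fun t (_ : t ∈ {t : ℝ≥0 | t ∈ I ∧ s k₀ ≤ t ∧
      (B.X x (t - s k₀) ω, t) ∈ G}) => (t : WithTop ℝ≥0)) (s k)
      ⟨((hJ _).1 h3).1, hs.monotone h2, h4⟩
  · refine le_iInf₂ fun t ht => ?_
    obtain ⟨ht1, ht2, ht3⟩ := ht
    have htJ : t ∈ J := (hJ t).2 ⟨ht1, hG _ ht3⟩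
    obtain ⟨j, rfl⟩ := hJs htJ
    refine WithTop.coe_le_coe.2 (hs.monotone (not_lt.1 fun hj => ?_))
    exact h1 j (hs.le_iff_le.1 ht2) hj ⟨htJ, ht3⟩

lemma exists_mem_firstEntry_or_entryTime_eq_top (hs : StrictMono s) (hJs : J ⊆ Set.range s)
    (hJ : ∀ t, t ∈ J ↔ t ∈ I ∧ (t : WithTop ℝ≥0) ≤ T) (hG : ∀ q ∈ G, (q.2 : WithTop ℝ≥0) ≤ T) :
    (∃ k, ω ∈ firstEntry (B.gridPath s x k₀) (fun k => {y | s k ∈ J ∧ (y, s k) ∈ G}) k₀ k) ∨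
      B.entryTime I G x (s k₀) ω = ⊤ := by
  classical
  by_cases hex : ∃ k, k₀ ≤ k ∧ s k ∈ J ∧ (B.gridPath s x k₀ k ω, s k) ∈ G
  · refine Or.inl ⟨Nat.find hex, fun j hj hlt hmem => Nat.find_min hex hlt ⟨hj, hmem⟩, ?_⟩
    exact Nat.find_spec hex
  · refine Or.inr ?_
    unfold entryTime
    refine top_unique (le_iInf₂ fun t ht => absurd ?_ hex)
    obtain ⟨ht1, ht2, ht3⟩ := ht
    have htJ : t ∈ J := (hJ t).2 ⟨ht1, hG _ ht3⟩
    obtain ⟨j, rfl⟩ := hJs htJ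
    exact ⟨j, hs.le_iff_le.1 ht2, htJ, ht3⟩

lemma setOf_entryTime_eq (hs : StrictMono s) (hJs : J ⊆ Set.range s)
    (hJ : ∀ t, t ∈ J ↔ t ∈ I ∧ (t : WithTop ℝ≥0) ≤ T) (hG : ∀ q ∈ G, (q.2 : WithTop ℝ≥0) ≤ T) :
    {ω | B.entryTime I G x (s k₀) ω = (s k : WithTop ℝ≥0)}
      = firstEntry (B.gridPath s x k₀) (fun k => {y | s k ∈ J ∧ (y, s k) ∈ G}) k₀ k := by
  ext ω
  refine ⟨fun h => ?_, B.entryTime_eq_of_mem_firstEntry hs hJs hJ hG⟩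
  have h : B.entryTime I G x (s k₀) ω = (s k : WithTop ℝ≥0) := h
  rcases B.exists_mem_firstEntry_or_entryTime_eq_top (k₀ := k₀) (x := x) (ω := ω) hs hJs hJ hG
    with ⟨j, hj⟩ | h1
  · have h2 := B.entryTime_eq_of_mem_firstEntry hs hJs hJ hG hj
    rw [h] at h2
    rwa [hs.injective (WithTop.coe_injective h2)]
  · rw [h] at h1
    exact absurd h1 WithTop.coe_ne_top

lemma entryTime_mem_grid (hs : StrictMono s) (hJs : J ⊆ Set.range s)
    (hJ : ∀ t, t ∈ J ↔ t ∈ I ∧ (t : WithTop ℝ≥0) ≤ T) (hG : ∀ q ∈ G, (q.2 : WithTop ℝ≥0) ≤ T)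
    (ω : Ω) : B.entryTime I G x (s k₀) ω = ⊤ ∨
      ∃ k, s k ∈ J ∧ B.entryTime I G x (s k₀) ω = (s k : WithTop ℝ≥0) := by
  rcases B.exists_mem_firstEntry_or_entryTime_eq_top (k₀ := k₀) (x := x) (ω := ω) hs hJs hJ hG
    with ⟨j, hj⟩ | h1
  · exact Or.inr ⟨j, hj.2.2.1, B.entryTime_eq_of_mem_firstEntry hs hJs hJ hG hj⟩
  · exact Or.inl h1

lemma lintegral_entryTime_eq_tsum (hg : Measurable g) (hs : StrictMono s) (hJs : J ⊆ Set.range s)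
    (hJ : ∀ t, t ∈ J ↔ t ∈ I ∧ (t : WithTop ℝ≥0) ≤ T) (hG : ∀ q ∈ G, (q.2 : WithTop ℝ≥0) ≤ T)
    (hD : ∀ k, MeasurableSet {y | s k ∈ J ∧ (y, s k) ∈ G}) (x : Fin d → ℝ) (k₀ : ℕ) :
    ∫⁻ ω, B.discountedPayoff g x (s k₀) (B.entryTime I G x (s k₀) ω) ω ∂(B.RN x)
      = ∑' k, ∫⁻ ω in firstEntry (B.gridPath s x k₀)
          (fun k => {y | s k ∈ J ∧ (y, s k) ∈ G}) k₀ k,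
          B.gridPayoff g s J k (B.gridPath s x k₀ k ω) ∂(B.RN x) := by
  rw [B.lintegral_discountedPayoff_eq_tsum hg hs x k₀ (B.entryTime_mem_grid hs hJs hJ hG)]
  · simp_rw [B.setOf_entryTime_eq hs hJs hJ hG]
  · intro k
    rw [B.setOf_entryTime_eq hs hJs hJ hG]
    exact (B.gridFiltration hs k₀).le k _
      (measurableSet_firstEntry (B.measurable_gridPath hs x k₀) hD k)

lemma ofReal_exp_mul_gridPayoff (hk : s k ∈ J) (y : Fin d → ℝ) :
    ENNReal.ofReal (Real.exp (B.r * s k)) * B.gridPayoff g s J k y = ENNReal.ofReal (g y) := by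
  rw [gridPayoff, if_pos hk, ← ENNReal.ofReal_mul (Real.exp_pos _).le, ← mul_assoc, ← Real.exp_add]
  simp

/-- The hitting value as the expected payoff at the entry time, also for starting points in `G`. -/
lemma hittingValue_eq_mul_lintegral (hs : StrictMono s) (hJs : J ⊆ Set.range s)
    (hJ : ∀ t, t ∈ J ↔ t ∈ I ∧ (t : WithTop ℝ≥0) ≤ T) (hG : ∀ q ∈ G, (q.2 : WithTop ℝ≥0) ≤ T)
    (x : Fin d → ℝ) (hk : s k₀ ∈ J) :
    B.hittingValue g I G x (s k₀) = ENNReal.ofReal (Real.exp (B.r * s k₀)) *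
      ∫⁻ ω, B.discountedPayoff g x (s k₀) (B.entryTime I G x (s k₀) ω) ω ∂(B.RN x) := by
  unfold hittingValue
  split_ifs with hx
  · have h1 : ∫⁻ ω, B.discountedPayoff g x (s k₀) (B.entryTime I G x (s k₀) ω) ω ∂(B.RN x)
        = ∫⁻ ω, B.gridPayoff g s J k₀ (B.gridPath s x k₀ k₀ ω) ∂(B.RN x) := by
      refine lintegral_congr_ae ?_
      filter_upwards [B.ae_X_zero_eq x] with ω hω
      have h2 : B.entryTime I G x (s k₀) ω = (s k₀ : WithTop ℝ≥0) := by
        refine B.entryTime_eq_of_mem_firstEntry hs hJs hJ hG ⟨fun j h1 h2 => by omega, le_rfl, hk, ?_⟩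
        rw [gridPath, tsub_self, hω]
        exact hx
      rw [h2, discountedPayoff_coe, gridPayoff, if_pos hk, gridPath]
    rw [h1, B.lintegral_gridPath_self, B.ofReal_exp_mul_gridPayoff hk]
  · rfl

end EntryTime

/-! ### The exercise region as a level set of the envelope, and its optimality. -/

lemma iSup_hittingValue_eq (hg : Measurable g) (hs : StrictMono s) (hJs : J ⊆ Set.range s)
    (hJ : ∀ t, t ∈ J ↔ t ∈ I ∧ (t : WithTop ℝ≥0) ≤ T) (x : Fin d → ℝ) {k₀ : ℕ} (hk : s k₀ ∈ J) :
    ⨆ G ∈ {G : Set ((Fin d → ℝ) × ℝ≥0) | MeasurableSet G ∧ ∀ q ∈ G, (q.2 : WithTop ℝ≥0) ≤ T},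
      B.hittingValue g I G x (s k₀) = ENNReal.ofReal (Real.exp (B.r * s k₀)) *
        snellValue (B.gridKernel s) (B.gridPayoff g s J) k₀ x := by
  have hh := fun k => B.measurable_gridPayoff (s := s) (J := J) hg k
  have hM := B.isMarkovChainFrom_gridPath hs x k₀
  have hY := B.measurable_gridPath hs x k₀
  apply le_antisymm
  · refine iSup₂_le fun G hG => ?_
    have hD : ∀ k, MeasurableSet {y | s k ∈ J ∧ (y, s k) ∈ G} := fun k =>
      (MeasurableSet.const _).inter (measurable_prodMk_right hG.1)
    rw [B.hittingValue_eq_mul_lintegral hs hJs hJ hG.2 x hk,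
      B.lintegral_entryTime_eq_tsum hg hs hJs hJ hG.2 hD]
    gcongr
    refine (tsum_payoff_le_snellValue hh hM (measurableSet_firstEntry hY hD)
      (pairwise_disjoint_firstEntry _) fun k hk => ?_).trans
      (B.lintegral_gridPath_self x k₀ _).le
    exact Set.eq_empty_of_forall_notMem fun ω hω => hk.not_ge hω.2.1
  · rw [snellValue, ENNReal.mul_iSup]
    refine iSup_le fun n => ?_
    -- The optimal stopping region for horizon `k₀ + n`, assembled from its slices at exercise
    -- times. It may depend on `n`, as only a supremum over regions is compared.
    set G : Set ((Fin d → ℝ) × ℝ≥0) := ⋃ k, {y | s k ∈ J ∧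
      stepsValue (B.gridKernel s) (B.gridPayoff g s J) (k₀ + n - k) k y
        ≤ B.gridPayoff g s J k y} ×ˢ {s k}
    have hGm : MeasurableSet G := MeasurableSet.iUnion fun k =>
      ((MeasurableSet.const _).inter (measurableSet_le (measurable_stepsValue hh _ k)
        (hh k))).prod (measurableSet_singleton _)
    have hGT : ∀ q ∈ G, (q.2 : WithTop ℝ≥0) ≤ T := by
      rintro ⟨y, u⟩ hq
      obtain ⟨k, ⟨hkJ, _⟩, hu⟩ := Set.mem_iUnion.1 hq
      have hu : u = s k := hu
      rw [hu]
      exact ((hJ _).1 hkJ).2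
    have hGD : ∀ k, {y | s k ∈ J ∧ (y, s k) ∈ G} = {y | s k ∈ J ∧
        stepsValue (B.gridKernel s) (B.gridPayoff g s J) (k₀ + n - k) k y
          ≤ B.gridPayoff g s J k y} := by
      intro k
      ext y
      constructor
      · rintro ⟨hkJ, hq⟩
        obtain ⟨j, hj, hu⟩ := Set.mem_iUnion.1 hq
        obtain rfl : k = j := hs.injective hu
        exact hj
      · exact fun hy => ⟨hy.1, Set.mem_iUnion.2 ⟨k, hy, rfl⟩⟩
    refine le_trans ?_ (le_iSup₂ (f := fun G (_ : G ∈ {G : Set ((Fin d → ℝ) × ℝ≥0) |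
      MeasurableSet G ∧ ∀ q ∈ G, (q.2 : WithTop ℝ≥0) ≤ T}) => B.hittingValue g I G x (s k₀))
      G ⟨hGm, hGT⟩)
    rw [B.hittingValue_eq_mul_lintegral hs hJs hJ hGT x hk,
      B.lintegral_entryTime_eq_tsum hg hs hJs hJ hGT fun k =>
        (MeasurableSet.const _).inter (measurable_prodMk_right hGm)]
    simp_rw [hGD]
    gcongr
    rw [← B.lintegral_gridPath_self (s := s) x k₀
      (stepsValue (B.gridKernel s) (B.gridPayoff g s J) n k₀)]
    exact stepsValue_le_tsum_firstEntry hh hY hM n (p := fun k => s k ∈ J)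
      fun k hkJ y => if_neg hkJ

/-- The positive finite factor `e^{r s k}` cancels. This also gives measurability of the slices at
exercise times, which the definition by an uncountable supremum does not show. -/
lemma mem_exerciseRegion_iff (hg : Measurable g) (hs : StrictMono s) (hJs : J ⊆ Set.range s)
    (hJ : ∀ t, t ∈ J ↔ t ∈ I ∧ (t : WithTop ℝ≥0) ≤ T) {k : ℕ} (hk : s k ∈ J) (y : Fin d → ℝ) :
    (y, s k) ∈ B.exerciseRegion g I T ↔
      snellValue (B.gridKernel s) (B.gridPayoff g s J) k y ≤ B.gridPayoff g s J k y := by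
  have h1 : (y, s k) ∈ B.exerciseRegion g I T ↔ (s k : WithTop ℝ≥0) ≤ T ∧
      (⨆ G ∈ {G : Set ((Fin d → ℝ) × ℝ≥0) | MeasurableSet G ∧ ∀ q ∈ G, (q.2 : WithTop ℝ≥0) ≤ T},
        B.hittingValue g I G y (s k)) ≤ ENNReal.ofReal (g y) := Iff.rfl
  rw [h1, B.iSup_hittingValue_eq hg hs hJs hJ y hk, ← B.ofReal_exp_mul_gridPayoff hk,
    ENNReal.mul_le_mul_iff_right (by simpa using Real.exp_pos _) ENNReal.ofReal_ne_top]
  exact and_iff_right ((hJ _).1 hk).2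

/-- Optimality of the immediate exercise region among the stopping times with values in the
exercise times up to `T`. -/
lemma hittingValue_exerciseRegion_eq (hg : Measurable g)
    (hJ : ∀ t, t ∈ J ↔ t ∈ I ∧ (t : WithTop ℝ≥0) ≤ T) (h0 : 0 ∈ J)
    (hfin : ∀ t, (J ∩ Set.Iic t).Finite) (x : Fin d → ℝ)
    (hint : ∫⁻ ω, ⨆ t ∈ J, ENNReal.ofReal (Real.exp (-B.r * t) * g (B.X x t ω)) ∂(B.RN x) < ∞)
    (hlim : ∀ᵐ ω ∂(B.RN x), Tendsto (fun t : ℝ≥0 => Real.exp (-B.r * t) * g (B.X x t ω))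
      (atTop ⊓ 𝓟 J) (𝓝 0)) :
    B.hittingValue g I (B.exerciseRegion g I T) x 0 = B.bermudanPrice g J ⊤ x := by
  obtain ⟨s, hs, hs0, hJs, hs_unbounded⟩ := exists_strictMono_grid hfin
  have hh := fun k => B.measurable_gridPayoff (s := s) (J := J) hg k
  have hM := B.isMarkovChainFrom_gridPath hs x 0
  have hY := B.measurable_gridPath hs x 0
  have hG : ∀ q ∈ B.exerciseRegion g I T, (q.2 : WithTop ℝ≥0) ≤ T := fun q hq => hq.1
  have h0s : s 0 ∈ J := hs0 ▸ h0
  set F := B.exerciseRegion g I T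
  have hDeq : ∀ k, {y | s k ∈ J ∧ (y, s k) ∈ F} = {y | s k ∈ J ∧
      snellValue (B.gridKernel s) (B.gridPayoff g s J) k y ≤ B.gridPayoff g s J k y} := by
    intro k
    ext y
    exact and_congr_right fun hk => B.mem_exerciseRegion_iff hg hs hJs hJ hk y
  have hD : ∀ k, MeasurableSet {y | s k ∈ J ∧ (y, s k) ∈ F} := by
    intro k
    rw [hDeq]
    exact (MeasurableSet.const _).inter (measurableSet_le (measurable_snellValue hh k) (hh k))
  have hV : B.hittingValue g I F x 0
      = ∫⁻ ω, B.discountedPayoff g x 0 (B.entryTime I F x 0 ω) ω ∂(B.RN x) := by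
    have h1 := B.hittingValue_eq_mul_lintegral (g := g) hs hJs hJ hG x h0s
    rw [hs0] at h1
    rw [h1]; simp
  have hgrid : ∀ ω k, B.gridPayoff g s J k (B.gridPath s x 0 k ω) ≤
      ⨆ t ∈ J, ENNReal.ofReal (Real.exp (-B.r * t) * g (B.X x t ω)) := by
    intro ω k
    rw [gridPayoff, gridPath, hs0, tsub_zero]
    split_ifs with hk
    · exact le_iSup₂ (f := fun (t : ℝ≥0) (_ : t ∈ J) =>
        ENNReal.ofReal (Real.exp (-B.r * t) * g (B.X x t ω))) (s k) hk
    · exact zero_le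
  -- Only this inequality needs the integrable supremum and the vanishing limit.
  have hlow : snellValue (B.gridKernel s) (B.gridPayoff g s J) 0 x ≤ B.hittingValue g I F x 0 := by
    have h1 := B.lintegral_entryTime_eq_tsum hg hs hJs hJ hG hD x 0
    rw [hs0] at h1
    rw [hV, h1, ← B.lintegral_gridPath_self (s := s) x 0
      (snellValue (B.gridKernel s) (B.gridPayoff g s J) 0)]
    refine snellValue_le_tsum_firstEntry hh hY hM hD ?_ ?_ ?_ ?_
    · intro k y hy
      rw [hDeq] at hy
      exact hy.2
    · intro k y hy
      rw [hDeq] at hy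
      by_cases hk : s k ∈ J
      · exact Or.inl (not_le.1 fun h => hy ⟨hk, h⟩)
      · exact Or.inr (if_neg hk)
    · exact ((lintegral_mono fun ω => iSup_le (hgrid ω)).trans_lt hint).ne
    · filter_upwards [hlim] with ω hω
      rw [ENNReal.tendsto_atTop_zero]
      intro ε hε
      have h2 := ENNReal.tendsto_ofReal hω
      rw [ENNReal.ofReal_zero] at h2
      have h3 := eventually_inf_principal.1 (h2.eventually (ge_mem_nhds hε))
      obtain ⟨N, hN⟩ := eventually_atTop.1 (hs_unbounded.eventually h3)
      refine ⟨N, fun n hn => ?_⟩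
      rw [gridPayoff, gridPath, hs0, tsub_zero]
      split_ifs with hk
      · exact hN n hn hk
      · exact zero_le
  apply le_antisymm
  -- The entry time is itself an admissible stopping time.
  · rw [hV]
    have hentry := B.entryTime_mem_grid (x := x) (k₀ := 0) hs hJs hJ hG
    have hset := fun k => B.setOf_entryTime_eq (x := x) (k₀ := 0) (k := k) hs hJs hJ hG
    rw [hs0] at hentry hset
    refine le_trans (lintegral_mono fun ω => ?_)
      (le_iSup₂ (f := fun τ (_ : τ ∈ {τ : Ω → WithTop ℝ≥0 | IsStoppingTime B.ℱ τ ∧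
        ∀ ω, τ ω = ⊤ ∨ ∃ t ∈ J, τ ω = (t : WithTop ℝ≥0)}) =>
        ∫⁻ ω, B.discountedPayoff g x 0 (min (τ ω) ⊤) ω ∂(B.RN x))
        (B.entryTime I F x 0) ⟨?_, fun ω => ?_⟩)
    · rw [min_eq_left le_top]
    · intro t
      have h1 : {ω | B.entryTime I F x 0 ω ≤ (t : WithTop ℝ≥0)}
          = ⋃ k, ⋃ (_ : s k ≤ t), {ω | B.entryTime I F x 0 ω = (s k : WithTop ℝ≥0)} := by
        ext ω
        simp only [Set.mem_iUnion, exists_prop]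
        constructor
        · intro hω
          have hω : B.entryTime I F x 0 ω ≤ (t : WithTop ℝ≥0) := hω
          rcases hentry ω with h2 | ⟨k, _, h2⟩
          · rw [h2] at hω
            exact absurd (top_unique hω) WithTop.coe_ne_top
          · exact ⟨k, WithTop.coe_le_coe.1 (h2 ▸ hω), h2⟩
        · rintro ⟨k, hk, h2⟩
          have h2 : B.entryTime I F x 0 ω = (s k : WithTop ℝ≥0) := h2
          exact h2.le.trans (WithTop.coe_le_coe.2 hk)
      rw [h1]
      refine MeasurableSet.iUnion fun k => MeasurableSet.iUnion fun hk => ?_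
      rw [hset]
      exact B.ℱ.mono (tsub_le_self.trans hk) _ (measurableSet_firstEntry hY hD k)
    · rcases hentry ω with h2 | ⟨k, hk, h2⟩
      · exact Or.inl h2
      · exact Or.inr ⟨s k, hk, h2⟩
  -- Every admissible stopping time pays at most the envelope at `x`.
  · refine le_trans ?_ hlow
    refine iSup₂_le fun τ hτ => ?_
    have hτ' : ∀ ω, τ ω = ⊤ ∨ ∃ k, s k ∈ J ∧ τ ω = (s k : WithTop ℝ≥0) := by
      intro ω
      rcases hτ.2 ω with h1 | ⟨t, ht, h1⟩
      · exact Or.inl h1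
      · obtain ⟨k, rfl⟩ := hJs ht
        exact Or.inr ⟨k, ht, h1⟩
    have hm : ∀ k, MeasurableSet[B.gridFiltration hs 0 k] {ω | τ ω = (s k : WithTop ℝ≥0)} := by
      intro k
      have h1 := hτ.1.measurableSet_eq (s k)
      have h2 : B.gridFiltration hs 0 k = B.ℱ (s k) := by
        change B.ℱ (s k - s 0) = _
        rw [hs0, tsub_zero]
      rwa [h2]
    have h1 := B.lintegral_discountedPayoff_eq_tsum hg hs x 0 hτ'
      fun k => (B.gridFiltration hs 0).le k _ (hm k)
    rw [hs0] at h1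
    simp only [min_top_right]
    rw [h1]
    refine (tsum_payoff_le_snellValue hh hM hm ?_ fun k hk => absurd hk k.not_lt_zero).trans
      (B.lintegral_gridPath_self x 0 _).le
    intro i j hij
    refine Set.disjoint_left.2 fun ω hi hj => hij ?_
    exact hs.injective (WithTop.coe_injective
      ((show τ ω = _ from hi).symm.trans (show τ ω = _ from hj)))

/-- If the maturity is itself an exercise time, then stopping there at the latest is no
restriction for a nonnegative payoff. -/
lemma bermudanPrice_restrict_eq (hT : ∃ t ∈ I, T = (t : WithTop ℝ≥0)) (x : Fin d → ℝ) :
    B.bermudanPrice g {t ∈ I | (t : WithTop ℝ≥0) ≤ T} ⊤ x = B.bermudanPrice g I T x := by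
  obtain ⟨u, hu, rfl⟩ := hT
  apply le_antisymm
  · refine iSup₂_le fun τ hτ => ?_
    refine le_trans (lintegral_mono fun ω => ?_)
      (le_iSup₂ (f := fun τ (_ : τ ∈ {τ : Ω → WithTop ℝ≥0 | IsStoppingTime B.ℱ τ ∧
        ∀ ω, τ ω = ⊤ ∨ ∃ t ∈ I, τ ω = (t : WithTop ℝ≥0)}) =>
        ∫⁻ ω, B.discountedPayoff g x 0 (min (τ ω) u) ω ∂(B.RN x)) τ
        ⟨hτ.1, fun ω => (hτ.2 ω).imp_right fun ⟨t, ht, h⟩ => ⟨t, ht.1, h⟩⟩)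
    rw [min_eq_left le_top]
    -- Where `τ = ⊤` the left side pays nothing, while the right side pays a nonnegative amount at
    -- `u`.
    rcases hτ.2 ω with h1 | ⟨t, ht, h1⟩
    · rw [h1]
      exact zero_le
    · rw [min_eq_left (h1 ▸ ht.2)]
  -- Conversely, `τ` capped at `u` takes values in the exercise times up to `u`, because `u ∈ I`.
  · refine iSup₂_le fun τ hτ => ?_
    refine le_trans (lintegral_mono fun ω => ?_)
      (le_iSup₂ (f := fun τ (_ : τ ∈ {τ : Ω → WithTop ℝ≥0 | IsStoppingTime B.ℱ τ ∧
        ∀ ω, τ ω = ⊤ ∨ ∃ t ∈ {t ∈ I | (t : WithTop ℝ≥0) ≤ (u : WithTop ℝ≥0)},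
          τ ω = (t : WithTop ℝ≥0)}) =>
        ∫⁻ ω, B.discountedPayoff g x 0 (min (τ ω) ⊤) ω ∂(B.RN x)) (fun ω => min (τ ω) u)
        ⟨hτ.1.min_const u, fun ω => Or.inr ?_⟩)
    · rw [min_eq_left (b := (⊤ : WithTop ℝ≥0)) le_top]
    · rcases le_total (τ ω) u with h1 | h1
      · rcases hτ.2 ω with h2 | ⟨t, ht, h2⟩
        · rw [h2] at h1
          exact absurd (top_unique h1) WithTop.coe_ne_top
        · exact ⟨t, ⟨ht, h2 ▸ h1⟩, (min_eq_left h1).trans h2⟩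
      · exact ⟨u, ⟨hu, le_rfl⟩, min_eq_right h1⟩

end FellerBasket

/-! ### The theorem for finite and infinite maturity. -/

theorem mainTheorem3 {d : ℕ} {Ω : Type*} [MeasurableSpace Ω] (B : FellerBasket d Ω)
    (f : (Fin d → ℝ) → ℝ) (hf : Measurable f) (K : ℝ)
    (g : (Fin d → ℝ) → ℝ) (hg : ∀ y, g y = max (K - f y) 0)
    (hsub : ∀ x, Submartingale (fun (t : ℝ≥0) ω => Real.exp (-B.r * t) * f (B.X x t ω))
      B.ℱ (B.RN x))
    (I : Set ℝ≥0) (hI : I.Countable) (h0 : 0 ∈ I) (T : WithTop ℝ≥0)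
    (hfin : ∀ t : ℝ≥0, (t : WithTop ℝ≥0) ≤ T → (I ∩ Set.Iic t).Finite) :
    (T ≠ ⊤ → ∀ x,
      B.hittingValue g I (B.exerciseRegion g I T) x 0 =
          B.bermudanPrice g {t ∈ I | (t : WithTop ℝ≥0) ≤ T} ⊤ x ∧
        ((∃ t ∈ I, T = (t : WithTop ℝ≥0)) →
          B.hittingValue g I (B.exerciseRegion g I T) x 0 = B.bermudanPrice g I T x)) ∧
    (T = ⊤ → ∀ x,
      ∫⁻ ω, ⨆ t ∈ I, ENNReal.ofReal (Real.exp (-B.r * t) * g (B.X x t ω)) ∂(B.RN x) < ∞ →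
      (∀ᵐ ω ∂(B.RN x), Tendsto (fun t : ℝ≥0 => Real.exp (-B.r * t) * g (B.X x t ω))
        (atTop ⊓ 𝓟 I) (𝓝 0)) →
      B.hittingValue g I (B.exerciseRegion g I T) x 0 = B.bermudanPrice g I T x) := by
  have hgm : Measurable g := by
    rw [funext hg]
    exact (measurable_const.sub hf).max measurable_const
  refine ⟨fun hT x => ?_, ?_⟩
  · obtain ⟨u, rfl⟩ := WithTop.ne_top_iff_exists.1 hT
    have hJfin : {t ∈ I | (t : WithTop ℝ≥0) ≤ (u : WithTop ℝ≥0)}.Finite :=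
      (hfin u le_rfl).subset fun t ht => ⟨ht.1, WithTop.coe_le_coe.1 ht.2⟩
    have hV := B.hittingValue_exerciseRegion_eq (g := g) (I := I) (T := u)
      (J := {t ∈ I | (t : WithTop ℝ≥0) ≤ (u : WithTop ℝ≥0)}) hgm (fun _ => Iff.rfl)
      ⟨h0, WithTop.coe_le_coe.2 zero_le⟩ (fun t => hJfin.subset Set.inter_subset_left) x ?_ ?_
    · exact ⟨hV, fun hT => hV.trans (B.bermudanPrice_restrict_eq hT x)⟩
    · have := (B.markov_riskNeutral x).isProbability
      -- The submartingale hypothesis supplies integrability of the discounted `f`, hence of each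
      -- payoff; the supremum over finitely many times is at most their sum.
      have hterm : ∀ t : ℝ≥0,
          ∫⁻ ω, ENNReal.ofReal (Real.exp (-B.r * t) * g (B.X x t ω)) ∂(B.RN x) < ∞ := by
        intro t
        have h1 : Integrable (fun ω => max (Real.exp (-B.r * t) * K
            - Real.exp (-B.r * t) * f (B.X x t ω)) 0) (B.RN x) :=
          ((integrable_const _).sub ((hsub x).integrable t)).pos_part
        refine (lintegral_mono fun ω => ENNReal.ofReal_le_ofReal ?_).trans_lt h1.lintegral_lt_top
        rw [hg, mul_max_of_nonneg _ _ (Real.exp_pos _).le, mul_sub, mul_zero]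
      refine lt_of_le_of_lt (lintegral_mono fun ω => ?_) (b := ∫⁻ ω, ∑ t ∈ hJfin.toFinset,
        ENNReal.ofReal (Real.exp (-B.r * t) * g (B.X x t ω)) ∂(B.RN x)) ?_
      · refine iSup₂_le fun t ht => ?_
        exact Finset.single_le_sum (f := fun t : ℝ≥0 =>
          ENNReal.ofReal (Real.exp (-B.r * t) * g (B.X x t ω))) (fun _ _ => zero_le)
          (hJfin.mem_toFinset.2 ht)
      · rw [lintegral_finsetSum]
        · exact ENNReal.sum_lt_top.2 fun t _ => hterm t
        · exact fun t _ => ((hgm.comp (B.measurable_X x t)).const_mul _).ennreal_ofReal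
    -- There are no exercise times beyond `u`, so the limit condition is vacuous.
    · have hbot : (atTop : Filter ℝ≥0) ⊓ 𝓟 {t ∈ I | (t : WithTop ℝ≥0) ≤ (u : WithTop ℝ≥0)} = ⊥ := by
        rw [inf_principal_eq_bot]
        filter_upwards [eventually_gt_atTop u] with t ht h1
        exact ht.not_ge (WithTop.coe_le_coe.1 h1.2)
      rw [hbot]
      exact Eventually.of_forall fun _ => tendsto_bot
  · rintro rfl x hint hlim
    exact B.hittingValue_exerciseRegion_eq hgm (fun t => ⟨fun h => ⟨h, le_top⟩, fun h => h.1⟩) h0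
      (fun t => hfin t le_top) x hint hlim
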